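/- Let $\mathbb F_q$ be a finite field with $q$ elements, $\mathcal R=\mathbb F_q[x]$, $\mathcal K=\mathbb F_q(x)$, and let $\tilde{\mathcal K}=\mathbb F_q((x^{-1}))$ be the completion of $\mathcal K$ with respect to the absolute value with $|f|=q^{\deg f}$ for $0\ne f\in\mathcal R$. Put $N(\mathbf v)=\prod_{i=1}^d|v_i|$ for $\mathbf v\in\tilde{\mathcal K}^d$. For $g\in \mathrm{GL}_d(\tilde{\mathcal K})$ and the homothety class $[g\mathcal R^d]$ of the lattice $g\mathcal R^d$, put $$\mu([g\mathcal R^d])=\frac{1}{|\det g|}\,\sup_{\mathbf v\in\tilde{\mathcal K}^d}\ \inf_{\mathbf u\in g\mathcal R^d}N(\mathbf v-\mathbf u).$$ Let $d\ge 2$ and let $a_1,\dots,a_d\in\mathcal R$ be distinct polynomials, all divisible by $x^2$. For $Q\in\mathcal R$ put $\mathbf Q=(Qa_1,\dots,Qa_d)$ and $P_{\mathbf Q}(T)=\prod_{i=1}^d(T-Qa_i)-1$. Theorem. For all but finitely many $Q\in\mathcal R$ the following hold. (0) $P_{\mathbf Q}$ is irreducible over $\mathcal K$ and, for a root $\theta$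 of it, the field $\mathcal K(\theta)$ has exactly $d$ embeddings $\sigma_1,\dots,\sigma_d$ over $\mathcal K$ into $\tilde{\mathcal K}$, which can be ordered in exactly one way such that $\theta_j:=\sigma_j(\theta)$ satisfies $|\theta_j-Qa_j|\le 1$ for all $j$. With this ordering let $\boldsymbol\sigma=(\sigma_1,\dots,\sigma_d)$, let $\Lambda_{\mathbf Q}=\mathrm{span}_{\mathcal R}\{1,\theta,\dots,\theta^{d-1}\}$, let $\mathfrak x_{\mathbf Q}$ be the homothety class of $\boldsymbol\sigma(\Lambda_{\mathbf Q})$, and, with $\omega_l=\theta-Qa_l$, put $$\Theta_{\mathbf Q}=(\theta_i^{\,j-1})_{i,j},\qquad M_{\mathbf Q}=\bigl(\sigma_i(\omega_1\cdots\omega_{j-1})\bigr)_{i,j},\qquad y_{\mathbf Q}=\Theta_{\mathbf Q}\left(\mathcal R^d+\left(\tfrac1x,\dots,\tfrac1x\right)^t\right).$$ (1) Every $\mathbf v\in y_{\mathbf Q}$ satisfies $N(\mathbf v)=\prod_{i=1}^d|v_i|\ \ge\ q^{-d}\,|\det M_{\mathbf Q}|$. (2) Consequently $\boldsymbol\sigma(\Lambda_{\mathbf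 Q})$ is a lattice (its homothety class contains some $g\mathcal R^d$ with $g\in\mathrm{GL}_d(\tilde{\mathcal K})$), and $\mu(\mathfrak x_{\mathbf Q})\ge q^{-d}$, whichever representative $g\mathcal R^d$ of $\mathfrak x_{\mathbf Q}$ is used to compute $\mu$. -/

import Mathlib

open Polynomial
open scoped NNReal ENNReal Matrix

noncomputable section

namespace MinkFF

/-- The completion `F((x⁻¹))` of the field `F(x)` of rational functions at the infinite place. -/
abbrev Kinf (F : Type*) [Field F] : Type _ :=
  @RatFunc.CompletionAtInfty F _ (Classical.decEq _)

/-- The inclusion of the polynomial ring `F[x]` into `F((x⁻¹))`. -/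
def emb (F : Type*) [Field F] : F[X] →+* Kinf F :=
  (algebraMap (RatFunc F) (Kinf F)).comp (algebraMap F[X] (RatFunc F))

/-- The absolute value on `F((x⁻¹))` that extends `|f| = q ^ deg f`, where `q = #F`. -/
def absInf {F : Type*} [Field F] [Fintype F] (z : Kinf F) : ℝ≥0 :=
  WithZeroMulInt.toNNReal (e := (Fintype.card F : ℝ≥0))
    (Nat.cast_ne_zero.mpr Fintype.card_ne_zero) (Valued.v z)

/-- `N(v) = ∏ |v_i|`. -/
def prodN {F : Type*} [Field F] [Fintype F] {d : ℕ} (v : Fin d → Kinf F) : ℝ≥0 :=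
  ∏ i, absInf (v i)

/-- `P(T) = ∏ (T - Q_i) - 1`, as a polynomial in `T` over `F(x)`. -/
def polyP {F : Type*} [Field F] {d : ℕ} (Q : Fin d → F[X]) : (RatFunc F)[X] :=
  ∏ i, (X - C (algebraMap F[X] (RatFunc F) (Q i))) - 1

/-- The extension `F(x)(θ)` of `F(x)` generated by a root `θ` of `P`. -/
abbrev FieldQ {F : Type*} [Field F] {d : ℕ} (Q : Fin d → F[X]) : Type _ :=
  AdjoinRoot (polyP Q)

/-- The root `θ`. -/
def theta {F : Type*} [Field F] {d : ℕ} (Q : Fin d → F[X]) : FieldQ Q :=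
  AdjoinRoot.root (polyP Q)

/-- The element `ω_l = θ - Q_l`. -/
def omega {F : Type*} [Field F] {d : ℕ} (Q : Fin d → F[X]) (l : Fin d) : FieldQ Q :=
  theta Q - algebraMap (RatFunc F) (FieldQ Q) (algebraMap F[X] (RatFunc F) (Q l))

/-- `σ` lists the embeddings of `F(x)(θ)` into `F((x⁻¹))`, each of them exactly once, in the order
in which the `j`-th root `σ_j(θ)` is the one near `Q_j`. -/
def IsOrdering {F : Type*} [Field F] [Fintype F] {d : ℕ} (Q : Fin d → F[X])
    (σ : Fin d → (FieldQ Q →ₐ[RatFunc F] Kinf F)) : Prop :=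
  Function.Bijective σ ∧ ∀ j, absInf (σ j (theta Q) - emb F (Q j)) ≤ 1

/-- The `F[x]`-module `Λ` spanned by `1, θ, …, θ ^ (d - 1)`. -/
def lamQ {F : Type*} [Field F] {d : ℕ} (Q : Fin d → F[X]) : Submodule F[X] (FieldQ Q) :=
  Submodule.span F[X] (Set.range fun k : Fin d => theta Q ^ (k : ℕ))

/-- The lattice `𝛔(Λ)`, where `𝛔 = (σ_1, …, σ_d)`. -/
def latticeX {F : Type*} [Field F] {d : ℕ} (Q : Fin d → F[X])
    (σ : Fin d → (FieldQ Q →ₐ[RatFunc F] Kinf F)) : Set (Fin d → Kinf F) :=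
  (fun (z : FieldQ Q) (i : Fin d) => σ i z) '' (lamQ Q : Set (FieldQ Q))

/-- The matrix with the entries `σ_i(ω_1 ⋯ ω_{j-1})`. -/
def matM {F : Type*} [Field F] {d : ℕ} (Q : Fin d → F[X])
    (σ : Fin d → (FieldQ Q →ₐ[RatFunc F] Kinf F)) : Matrix (Fin d) (Fin d) (Kinf F) :=
  Matrix.of fun i j => σ i (∏ l ∈ Finset.Iio j, omega Q l)

/-- The Vandermonde matrix with the entries `θ_i ^ (j - 1)`, where `θ_i = σ_i(θ)`. -/
def matTheta {F : Type*} [Field F] {d : ℕ} (Q : Fin d → F[X])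
    (σ : Fin d → (FieldQ Q →ₐ[RatFunc F] Kinf F)) : Matrix (Fin d) (Fin d) (Kinf F) :=
  Matrix.of fun i j => σ i (theta Q) ^ (j : ℕ)

/-- The grid `Θ (F[x]^d + (1/x, …, 1/x))`. -/
def gridY {F : Type*} [Field F] {d : ℕ} (Q : Fin d → F[X])
    (σ : Fin d → (FieldQ Q →ₐ[RatFunc F] Kinf F)) : Set (Fin d → Kinf F) :=
  Set.range fun b : Fin d → F[X] => matTheta Q σ *ᵥ fun k => emb F (b k) + (emb F X)⁻¹

/-- The lattice `g F[x]^d`. -/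
def latticeOf {F : Type*} [Field F] {d : ℕ} (g : GL (Fin d) (Kinf F)) : Set (Fin d → Kinf F) :=
  Set.range fun b : Fin d → F[X] => (g : Matrix (Fin d) (Fin d) (Kinf F)) *ᵥ fun k => emb F (b k)

/-- The lattice `g F[x]^d` lies in the homothety class of `L`. -/
def Represents {F : Type*} [Field F] {d : ℕ} (g : GL (Fin d) (Kinf F))
    (L : Set (Fin d → Kinf F)) : Prop :=
  ∃ c : Kinf F, c ≠ 0 ∧ latticeOf g = (fun u => c • u) '' L

/-- Minkowski's function `μ` at the homothety class of `g F[x]^d`, computed from `g`: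
`|det g|⁻¹ sup_v inf_u N(v - u)`, with `u` in `g F[x]^d`. -/
def mu {F : Type*} [Field F] [Fintype F] {d : ℕ} (g : GL (Fin d) (Kinf F)) : ℝ≥0∞ :=
  (⨆ v : Fin d → Kinf F, ⨅ u ∈ latticeOf g, (prodN (v - u) : ℝ≥0∞)) /
    (absInf (g : Matrix (Fin d) (Fin d) (Kinf F)).det : ℝ≥0∞)

end MinkFF

end

/-! On a logarithmic scale, multiplication by the units `ω_l` is a chip-firing game. The grid `y` is
the image of `Λ + x⁻¹(1 + θ + ⋯ + θ^(d-1))`. Since `x ∣ Q_l` and `∏ ω_l = 1`, one has `θ^d ≡ 1`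
modulo `xΛ`, so every `ω_l` maps this grid into itself (`omega_mul_mem_gridE`). Moreover `|σ_j(ω_l)|
= |Q_j - Q_l|` for `j ≠ l`, and `∏ ω_l = 1` then forces `|σ_l(ω_l)| = ∏_{j≠l} |Q_j - Q_l|⁻¹`. With
`D_i = log_q |σ_i(z)| + 1` chips at vertex `i`, passing from `z` to `ω_l z` thus fires `l` in the
complete graph whose edge multiplicities are `deg(Q_i - Q_j)`.

A legal move always exists: the coefficient of `θ^(d-1)` in `z` has the form `b + 1/x`, of absolute
value at least `q⁻¹`, and Lagrange interpolation makes some `|σ_i(z)|` at least `q⁻¹ ∏_{l≠i} |θ_i -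
θ_l|` (`exists_large_of_mem_gridE`). An endless game needs as many chips as there are edges
(`sum_le_two_mul_sum_of_forall_exists_fire`). There are `d + log_q N(z)` chips and `log_q |det Θ|`
edges, and `det Θ = det M`; this is (1).

For (0), a contraction yields a root near each `Q_j`, and the unit values of a factor at the `Q_k`
exclude a factorisation. For (2), the supremum in `μ` is tested at the shift vector of the grid. -/

noncomputable section

open scoped WithZero

namespace MinkFF

/-! ### Contractions and products under a discrete valuation -/

section Valued

variable {K : Type*} [Field K] [hv : Valued K ℤᵐ⁰]

theorem exists_exp_neg_lt {γ : ℤᵐ⁰} (hγ : γ ≠ 0) : ∃ n : ℕ, WithZero.exp (-(n : ℤ)) < γ := by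
  refine ⟨(1 - WithZero.log γ).toNat, ?_⟩
  conv_rhs => rw [← WithZero.exp_log hγ]
  rw [WithZero.exp_lt_exp]
  omega

/-- A map of the closed unit ball into itself that contracts distances by a factor `exp (-1)`
has a fixed point in the ball. -/
theorem exists_fixedPoint_of_contracting [CompleteSpace K] (φ : K → K)
    (h1 : ∀ s, Valued.v s ≤ 1 → Valued.v (φ s) ≤ 1)
    (h2 : ∀ s t, Valued.v s ≤ 1 → Valued.v t ≤ 1 →
      Valued.v (φ s - φ t) ≤ WithZero.exp (-1) * Valued.v (s - t)) :
    ∃ s, Valued.v s ≤ 1 ∧ φ s = s := by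
  set a : ℕ → K := fun n => φ^[n] 0
  have ha1 : ∀ n, a (n + 1) = φ (a n) := fun n => Function.iterate_succ_apply' _ _ _
  have hb : ∀ n, Valued.v (a n) ≤ 1 := by
    intro n
    induction n with
    | zero => simp [a]
    | succ n ih => rw [ha1]; exact h1 _ ih
  have hs : ∀ n, Valued.v (a (n + 1) - a n) ≤ WithZero.exp (-(n : ℤ)) := by
    intro n
    induction n with
    | zero =>
      have : a 0 = 0 := rfl
      rw [this, sub_zero]
      simpa using hb 1
    | succ n ih =>
      rw [ha1 (n + 1)]
      nth_rewrite 2 [ha1 n]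
      refine (h2 _ _ (hb _) (hb _)).trans ?_
      have : WithZero.exp (-((n + 1 : ℕ) : ℤ)) = WithZero.exp (-1) * WithZero.exp (-(n : ℤ)) := by
        rw [← WithZero.exp_add]
        congr 1
        push_cast
        ring
      rw [this]
      gcongr
  have hm : ∀ n k, Valued.v (a (n + k) - a n) ≤ WithZero.exp (-(n : ℤ)) := by
    intro n k
    induction k with
    | zero => simp
    | succ k ih =>
      have : a (n + (k + 1)) - a n = (a (n + k + 1) - a (n + k)) + (a (n + k) - a n) := by
        rw [add_assoc]; ring
      rw [this]
      refine Valuation.map_add_le _ ((hs (n + k)).trans ?_) ih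
      rw [WithZero.exp_le_exp]
      push_cast
      omega
  have hc : CauchySeq a := by
    refine Valued.cauchy_iff.mpr ⟨Filter.map_neBot, fun γ => ?_⟩
    have hne : MonoidWithZeroHom.ValueGroup₀.embedding γ.1 ≠ (0 : ℤᵐ⁰) := by
      simp
    obtain ⟨N, hN⟩ := exists_exp_neg_lt hne
    refine ⟨a '' Set.Ici N, Filter.image_mem_map (Filter.Ici_mem_atTop N), ?_⟩
    rintro _ ⟨m, hm', rfl⟩ _ ⟨n, hn', rfl⟩
    obtain ⟨k, rfl⟩ := Nat.exists_eq_add_of_le (Set.mem_Ici.mp hm')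
    obtain ⟨l, rfl⟩ := Nat.exists_eq_add_of_le (Set.mem_Ici.mp hn')
    rw [Valuation.restrict_lt_iff_lt_embedding]
    refine lt_of_le_of_lt ?_ hN
    rw [← sub_sub_sub_cancel_right _ _ (a N)]
    exact Valuation.map_sub_le _ (hm N l) (hm N k)
  obtain ⟨b, hb'⟩ := cauchySeq_tendsto_of_complete hc
  have hlim : ∀ n, Valued.v (b - a n) ≤ WithZero.exp (-(n : ℤ)) := by
    intro n
    by_cases h0 : Valued.v (b - a n) = 0
    · rw [h0]; exact zero_le
    have ht : Filter.Tendsto (fun m => a m - a n) Filter.atTop (nhds (b - a n)) :=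
      hb'.sub_const _
    -- The valuation is locally constant away from `0`, so the limit `b - a n` has the same value as
    -- some `a m - a n` with `m ≥ n`.
    obtain ⟨m, hm1, hm2⟩ := ((ht.eventually (Valued.locally_const h0)).and
      (Filter.eventually_ge_atTop n)).exists
    have hm1 : Valued.v (a m - a n) = Valued.v (b - a n) := hm1
    rw [← hm1]
    obtain ⟨k, rfl⟩ := Nat.exists_eq_add_of_le hm2
    exact hm n k
  have hbb : Valued.v b ≤ 1 := by
    have := hlim 0
    simpa [a] using this
  refine ⟨b, hbb, ?_⟩
  by_contra hne
  have hne' : Valued.v (φ b - b) ≠ 0 := by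
    rw [Valuation.ne_zero_iff]
    exact sub_ne_zero.mpr hne
  obtain ⟨n, hn⟩ := exists_exp_neg_lt hne'
  refine absurd hn (not_lt.mpr ?_)
  have : φ b - b = (φ b - φ (a n)) + (a (n + 1) - b) := by rw [ha1]; ring
  rw [this]
  refine Valuation.map_add_le _ ?_ ?_
  · refine (h2 _ _ hbb (hb n)).trans ?_
    calc _ ≤ 1 * WithZero.exp (-(n : ℤ)) := by
          refine mul_le_mul' ?_ (hlim n)
          rw [← WithZero.exp_zero, WithZero.exp_le_exp]; omega
      _ = _ := one_mul _
  · rw [Valuation.map_sub_swap]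
    refine (hlim (n + 1)).trans ?_
    rw [WithZero.exp_le_exp]
    push_cast
    omega

end Valued

/-- Perturbing each factor of a product by at most `ε`. -/
theorem map_prod_sub_prod_le {K ι : Type*} [Field K] (v : Valuation K ℤᵐ⁰) (s : Finset ι) (a b : ι → K)
    (c : ι → ℤᵐ⁰) (ε : ℤᵐ⁰) (hc : ∀ i ∈ s, 1 ≤ c i) (ha : ∀ i ∈ s, v (a i) ≤ c i)
    (hb : ∀ i ∈ s, v (b i) ≤ c i) (hab : ∀ i ∈ s, v (a i - b i) ≤ ε) :
    v (∏ i ∈ s, a i - ∏ i ∈ s, b i) ≤ ε * ∏ i ∈ s, c i := by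
  classical
  induction s using Finset.induction_on with
  | empty => simp
  | insert i s hi ih =>
    simp only [Finset.forall_mem_insert] at hc ha hb hab
    specialize ih hc.2 ha.2 hb.2 hab.2
    rw [Finset.prod_insert hi, Finset.prod_insert hi, Finset.prod_insert hi]
    have : a i * ∏ x ∈ s, a x - b i * ∏ x ∈ s, b x =
      (a i - b i) * ∏ x ∈ s, a x + b i * (∏ x ∈ s, a x - ∏ x ∈ s, b x) := by ring
    rw [this]
    refine Valuation.map_add_le _ ?_ ?_
    · rw [map_mul, map_prod]
      refine mul_le_mul' hab.1 ?_
      calc ∏ x ∈ s, v (a x) ≤ ∏ x ∈ s, c x := Finset.prod_le_prod' fun x hx => ha.2 x hx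
        _ ≤ c i * ∏ x ∈ s, c x := by
          conv_lhs => rw [← one_mul (∏ x ∈ s, c x)]
          exact mul_le_mul' hc.1 le_rfl
    · rw [map_mul, mul_left_comm]
      exact mul_le_mul' hb.1 ih

/-! ### Chip-firing on a complete graph -/

/-- Firing the vertex `i` in the chip-firing game with edge multiplicities `L`. -/
def fire {ι : Type*} [Fintype ι] [DecidableEq ι] (L : ι → ι → ℤ) (i : ι) (D : ι → ℤ) : ι → ℤ :=
  fun j => if j = i then D i - ∑ l ∈ Finset.univ.erase i, L i l else D j + L i j

theorem sum_fire {ι : Type*} [Fintype ι] [DecidableEq ι] (L : ι → ι → ℤ) (i : ι) (D : ι → ℤ) :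
    ∑ j, fire L i D j = ∑ j, D j := by
  rw [← Finset.add_sum_erase _ _ (Finset.mem_univ i), ← Finset.add_sum_erase _ D (Finset.mem_univ i)]
  have : ∑ j ∈ Finset.univ.erase i, fire L i D j =
      ∑ j ∈ Finset.univ.erase i, (D j + L i j) :=
    Finset.sum_congr rfl fun j hj => if_neg (Finset.ne_of_mem_erase hj)
  rw [this, Finset.sum_add_distrib]
  simp only [fire, if_true]
  ring

/-- After `T` legal moves of the game, if `t i` is the time of the last firing of `i` (and `0` if
`i` has not been fired), then `i` holds the chips that it received since. -/
theorem exists_fire_history {ι : Type*} [Fintype ι] [DecidableEq ι] (L : ι → ι → ℤ)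
    (hL : ∀ i j, i ≠ j → 1 ≤ L i j) (hsymm : ∀ i j, L i j = L j i) (S : Set (ι → ℤ))
    (hS : ∀ D ∈ S, ∃ i, ∑ l ∈ Finset.univ.erase i, L i l ≤ D i ∧ fire L i D ∈ S)
    (D₀ : ι → ℤ) (hD₀ : D₀ ∈ S) (T : ℕ) :
    ∃ D ∈ S, ∃ t : ι → ℕ, (∀ i, t i ≤ T) ∧ (∀ i j, 0 < t i → t i = t j → i = j) ∧
      (∀ i, 0 < t i → ∑ j with t i < t j, L i j ≤ D i) ∧
      (∀ i, t i = 0 → D₀ i + T ≤ D i) ∧ ∑ i, D i = ∑ i, D₀ i := by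
  induction T with
  | zero => exact ⟨D₀, hD₀, fun _ => 0, by simp, by simp, by simp, by simp, rfl⟩
  | succ T ih =>
    obtain ⟨D, hD, t, ht, hinj, hpos, hzero, hsum⟩ := ih
    obtain ⟨i, hi, hfire⟩ := hS D hD
    have hne : ∀ j, t j ≠ T + 1 := fun j => by have := ht j; omega
    refine ⟨_, hfire, Function.update t i (T + 1), ?_, ?_, ?_, ?_, ?_⟩
    · intro j
      rcases eq_or_ne i j with rfl | h
      · simp
      · simp only [Function.update_of_ne h.symm]; have := ht j; omega
    · intro j k hj hjk
      rcases eq_or_ne i j with rfl | h <;> rcases eq_or_ne i k with h' | h'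
      · exact h'
      · simp only [Function.update_self, Function.update_of_ne h'.symm] at hjk
        exact absurd hjk.symm (hne k)
      · subst h'
        simp only [Function.update_self, Function.update_of_ne h.symm] at hjk
        exact absurd hjk (hne j)
      · simp only [Function.update_of_ne h.symm, Function.update_of_ne h'.symm] at hj hjk
        exact hinj j k hj hjk
    · intro j hj
      rcases eq_or_ne i j with rfl | h
      · simp only [Function.update_self, fire, if_true]
        -- Nothing has been fired after `i`, so only nonnegativity is needed, and this is the
        -- legality of the move.
        rw [Finset.sum_eq_zero]
        · omega
        · intro k hk
          rw [Finset.mem_filter] at hk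
          rcases eq_or_ne i k with rfl | h'
          · simp at hk
          · simp only [Function.update_of_ne h'.symm] at hk
            have := ht k
            omega
      · simp only [Function.update_of_ne h.symm] at hj ⊢
        simp only [fire, if_neg h.symm]
        -- Only `i` can join the vertices fired since `j`, and the chips just sent along the edge
        -- from `i` to `j` pay for it.
        have hsub : Finset.univ.filter (fun k => t j < Function.update t i (T + 1) k) ⊆
            insert i (Finset.univ.filter (fun k => t j < t k)) := by
          intro k hk
          rcases eq_or_ne i k with rfl | h'
          · simp
          · simpa [Function.update_of_ne h'.symm, h'.symm] using hk
        refine (Finset.sum_le_sum_of_subset_of_nonneg hsub ?_).trans ?_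
        · intro k hk _
          have hjk : j ≠ k := by
            rintro rfl
            simp [h.symm] at hk
          have := hL j k hjk
          omega
        · have h1 := hpos j hj
          have h2 := hL i j h
          by_cases hmem : i ∈ Finset.univ.filter (fun k => t j < t k)
          · rw [Finset.insert_eq_of_mem hmem]
            omega
          · rw [Finset.sum_insert hmem, hsymm j i]
            omega
    · intro j hj
      rcases eq_or_ne i j with rfl | h
      · simp at hj
      · simp only [Function.update_of_ne h.symm] at hj
        simp only [fire, if_neg h.symm]
        have := hzero j hj
        have := hL i j h
        push_cast
        omega
    · rw [sum_fire, hsum]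

/-- An infinite chip-firing game on a complete graph needs at least as many chips as the graph
has edges. -/
theorem sum_le_two_mul_sum_of_forall_exists_fire {ι : Type*} [Fintype ι] [DecidableEq ι]
    (L : ι → ι → ℤ) (hL : ∀ i j, i ≠ j → 1 ≤ L i j) (hsymm : ∀ i j, L i j = L j i)
    (S : Set (ι → ℤ))
    (hS : ∀ D ∈ S, ∃ i, ∑ l ∈ Finset.univ.erase i, L i l ≤ D i ∧ fire L i D ∈ S)
    (D₀ : ι → ℤ) (hD₀ : D₀ ∈ S) :
    ∑ i, ∑ l ∈ Finset.univ.erase i, L i l ≤ 2 * ∑ i, D₀ i := by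
  -- After this many moves, a vertex never fired would alone exceed the conserved total, even
  -- against the worst possible debts of the others.
  set T : ℕ := (∑ i, |D₀ i| + ∑ i, D₀ i + 1 + ∑ i, |D₀ i|).toNat with hT
  obtain ⟨D, -, t, -, hinj, hpos, hzero, hsum⟩ :=
    exists_fire_history L hL hsymm S hS D₀ hD₀ T
  have hnn : ∀ i, 0 < t i → 0 ≤ D i := fun i hi => by
    refine le_trans (Finset.sum_nonneg fun j hj => ?_) (hpos i hi)
    have hij : i ≠ j := by
      rintro rfl
      simp at hj
    have := hL i j hij
    omega
  have hall : ∀ i, 0 < t i := by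
    by_contra! hcon
    obtain ⟨i, hi⟩ := hcon
    have hi0 : t i = 0 := by omega
    have hlow : ∀ j, -|D₀ j| ≤ D j := fun j => by
      rcases Nat.eq_zero_or_pos (t j) with h | h
      · have := hzero j h
        have := neg_abs_le (D₀ j)
        omega
      · have := hnn j h
        have := abs_nonneg (D₀ j)
        omega
    have h1 : ∑ j, D j = D i + ∑ j ∈ Finset.univ.erase i, D j :=
      (Finset.add_sum_erase _ _ (Finset.mem_univ i)).symm
    have h2 : ∑ j, |D₀ j| = |D₀ i| + ∑ j ∈ Finset.univ.erase i, |D₀ j| :=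
      (Finset.add_sum_erase _ _ (Finset.mem_univ i)).symm
    have h3 : ∑ j ∈ Finset.univ.erase i, -|D₀ j| ≤ ∑ j ∈ Finset.univ.erase i, D j :=
      Finset.sum_le_sum fun j _ => hlow j
    rw [Finset.sum_neg_distrib] at h3
    have h4 := hzero i hi0
    have h5 := neg_abs_le (D₀ i)
    have h6 : (∑ i, |D₀ i| + ∑ i, D₀ i + 1 + ∑ i, |D₀ i| : ℤ) ≤ T := by
      rw [hT]; exact Int.self_le_toNat _
    have h7 : 0 ≤ ∑ j, |D₀ j| := Finset.sum_nonneg fun j _ => abs_nonneg _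
    have h8 := abs_nonneg (D₀ i)
    omega
  -- The last firing times are distinct, so every edge is counted once, at its endpoint fired
  -- earlier.
  have key : ∑ i, ∑ j with t i < t j, L i j ≤ ∑ i, D₀ i :=
    hsum ▸ Finset.sum_le_sum fun i _ => hpos i (hall i)
  have hswap : ∑ i, ∑ j with t i < t j, L i j = ∑ i, ∑ j with t j < t i, L i j := by
    simp only [Finset.sum_filter]
    rw [Finset.sum_comm]
    refine Finset.sum_congr rfl fun i _ => Finset.sum_congr rfl fun j _ => ?_
    rw [hsymm]
  have hsplit : ∑ i, ∑ l ∈ Finset.univ.erase i, L i l =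
      ∑ i, ∑ j with t i < t j, L i j + ∑ i, ∑ j with t j < t i, L i j := by
    rw [← Finset.sum_add_distrib]
    refine Finset.sum_congr rfl fun i _ => ?_
    rw [← Finset.sum_union]
    · refine Finset.sum_congr ?_ fun _ _ => rfl
      ext j
      simp only [Finset.mem_erase, Finset.mem_univ, and_true, Finset.mem_union,
        Finset.mem_filter, true_and]
      constructor
      · intro h
        have : t i ≠ t j := fun h' => h (hinj i j (hall i) h').symm
        omega
      · rintro h rfl
        omega
    · rw [Finset.disjoint_filter]
      intro j _ h1 h2
      omega
  rw [hsplit, ← hswap]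
  linarith

/-! ### The valuation at infinity and separated polynomials -/

instance completeSpace_Kinf {F : Type*} [Field F] : CompleteSpace (Kinf F) :=
  letI : DecidableEq (RatFunc F) := Classical.decEq _
  letI := RatFunc.inftyValued F
  inferInstanceAs (CompleteSpace (UniformSpace.Completion (RatFunc F)))

section Field

variable {F : Type*} [Field F]

theorem v_emb {p : F[X]} (hp : p ≠ 0) :
    Valued.v (emb F p) = WithZero.exp (p.natDegree : ℤ) := by
  let _ : DecidableEq (RatFunc F) := Classical.decEq _
  let _ := RatFunc.inftyValued F
  exact (Valued.valuedCompletion_apply (algebraMap F[X] (RatFunc F) p)).trans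
    (RatFunc.inftyValuation.polynomial F hp)

theorem one_le_v_emb {p : F[X]} (hp : p ≠ 0) : 1 ≤ Valued.v (emb F p) := by
  rw [v_emb hp, ← WithZero.exp_zero, WithZero.exp_le_exp]
  omega

theorem emb_injective : Function.Injective (emb F) :=
  (algebraMap (RatFunc F) (Kinf F)).injective.comp (IsFractionRing.injective F[X] (RatFunc F))

theorem v_emb_of_isUnit {p : F[X]} (hp : IsUnit p) : Valued.v (emb F p) = 1 := by
  rw [v_emb hp.ne_zero, Polynomial.natDegree_eq_zero_of_isUnit hp]
  simp

theorem one_lt_finset_prod {ι : Type*} {s : Finset ι} {f : ι → ℤᵐ⁰} (hs : s.Nonempty)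
    (hf : ∀ i ∈ s, 1 < f i) : 1 < ∏ i ∈ s, f i := by
  classical
  obtain ⟨i, hi⟩ := hs
  rw [← Finset.mul_prod_erase _ _ hi]
  have h1 : 1 ≤ ∏ x ∈ s.erase i, f x :=
    Finset.one_le_prod' fun x hx => (hf x (Finset.mem_of_mem_erase hx)).le
  calc 1 < f i := hf i hi
    _ = f i * 1 := (mul_one _).symm
    _ ≤ _ := mul_le_mul' le_rfl h1

variable {d : ℕ}

/-- The polynomials `Q_i` have pairwise distance greater than `1`. -/
def Separated (Q : Fin d → F[X]) : Prop :=
  ∀ i j, i ≠ j → 1 < Valued.v (emb F (Q i) - emb F (Q j))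

variable {Q : Fin d → F[X]}

theorem v_sub_emb (hQ : Separated Q) {i l : Fin d} (hil : i ≠ l) {z : Kinf F}
    (hz : Valued.v (z - emb F (Q i)) ≤ 1) :
    Valued.v (z - emb F (Q l)) = Valued.v (emb F (Q i) - emb F (Q l)) := by
  rw [← sub_add_sub_cancel z (emb F (Q i)) (emb F (Q l))]
  exact Valuation.map_add_eq_of_lt_right _ (hz.trans_lt (hQ i l hil))

theorem v_sub_of_near (hQ : Separated Q) {i l : Fin d} (hil : i ≠ l) {z w : Kinf F}
    (hz : Valued.v (z - emb F (Q i)) ≤ 1) (hw : Valued.v (w - emb F (Q l)) ≤ 1) :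
    Valued.v (z - w) = Valued.v (emb F (Q i) - emb F (Q l)) := by
  rw [← sub_sub_sub_cancel_right z w (emb F (Q l)), ← v_sub_emb hQ hil hz]
  refine Valuation.map_sub_eq_of_lt_left _ (hw.trans_lt ?_)
  rw [v_sub_emb hQ hil hz]
  exact hQ i l hil

theorem Separated.eq_of_near (hQ : Separated Q) {i l : Fin d} {z : Kinf F}
    (hz : Valued.v (z - emb F (Q i)) ≤ 1) (hz' : Valued.v (z - emb F (Q l)) ≤ 1) : i = l := by
  by_contra hil
  rw [v_sub_emb hQ hil hz] at hz'
  exact absurd (hQ i l hil) (not_lt.mpr hz')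

/-! ### Roots and irreducibility of `P` -/

theorem aeval_polyP {A : Type*} [CommRing A] [Algebra (RatFunc F) A] (Q : Fin d → F[X]) (z : A) :
    aeval z (polyP Q) = ∏ i, (z - algebraMap (RatFunc F) A (algebraMap F[X] (RatFunc F) (Q i))) - 1 := by
  simp [polyP, map_prod]

theorem aeval_Kinf_polyP (Q : Fin d → F[X]) (z : Kinf F) :
    aeval z (polyP Q) = ∏ i, (z - emb F (Q i)) - 1 :=
  aeval_polyP Q z

/-- Near each `Q_j` there is a root of `P`. -/
theorem exists_root_near (hd : 2 ≤ d) (hQ : Separated Q) (j : Fin d) :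
    ∃ z : Kinf F, Valued.v (z - emb F (Q j)) ≤ 1 ∧ ∏ i, (z - emb F (Q i)) = 1 := by
  set Δ : Fin d → Kinf F := fun i => emb F (Q j) - emb F (Q i) with hΔ
  set s := (Finset.univ.erase j : Finset (Fin d))
  set f : Kinf F → Kinf F := fun z => ∏ i ∈ s, (z + Δ i) with hf
  set c : ℤᵐ⁰ := ∏ i ∈ s, Valued.v (Δ i) with hc
  have hne : s.Nonempty := by
    rw [← Finset.card_pos, Finset.card_erase_of_mem (Finset.mem_univ j), Finset.card_univ,
      Fintype.card_fin]
    omega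
  have hΔ1 : ∀ i ∈ s, 1 < Valued.v (Δ i) := fun i hi => hQ j i (Finset.ne_of_mem_erase hi).symm
  have hc1 : 1 < c := one_lt_finset_prod hne hΔ1
  have hc0 : c ≠ 0 := (zero_lt_one.trans hc1).ne'
  have hadd : ∀ z : Kinf F, Valued.v z ≤ 1 → ∀ i ∈ s, Valued.v (z + Δ i) = Valued.v (Δ i) :=
    fun z hz i hi => Valuation.map_add_eq_of_lt_right _ (hz.trans_lt (hΔ1 i hi))
  have hfv : ∀ z, Valued.v z ≤ 1 → Valued.v (f z) = c := fun z hz => by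
    rw [hf, map_prod]
    exact Finset.prod_congr rfl (hadd z hz)
  have hf0 : ∀ z, Valued.v z ≤ 1 → f z ≠ 0 := fun z hz => by
    rw [← Valuation.ne_zero_iff Valued.v, hfv z hz]
    exact hc0
  -- The value group is discrete, so `c > 1` already gives the contraction factor.
  have hcinv : c⁻¹ ≤ WithZero.exp (-1) := by
    rw [WithZero.exp_neg]
    refine inv_anti₀ (WithZero.exp_pos) ?_
    rw [← WithZero.exp_log hc0, ← WithZero.exp_zero, WithZero.exp_lt_exp] at hc1
    rw [← WithZero.exp_log hc0, WithZero.exp_le_exp]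
    omega
  -- With `T = z + Q_j`, the equation `P(T) = 0` reads `z * f z = 1`, that is, `z = (f z)⁻¹`.
  obtain ⟨z, hz, hfix⟩ := exists_fixedPoint_of_contracting (fun z => (f z)⁻¹) (fun z hz => by
      rw [map_inv₀, hfv z hz]
      exact inv_le_one_of_one_le₀ hc1.le) (fun z w hz hw => by
      have : (f z)⁻¹ - (f w)⁻¹ = (f w - f z) * ((f z)⁻¹ * (f w)⁻¹) := by
        have := hf0 z hz
        have := hf0 w hw
        field_simp
      rw [this, map_mul, map_mul, map_inv₀, map_inv₀, hfv z hz, hfv w hw]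
      have h := map_prod_sub_prod_le Valued.v s (fun i => w + Δ i) (fun i => z + Δ i)
        (fun i => Valued.v (Δ i)) (Valued.v (z - w)) (fun i hi => (hΔ1 i hi).le)
        (fun i hi => (hadd w hw i hi).le) (fun i hi => (hadd z hz i hi).le)
        (fun i _ => by rw [Valuation.map_sub_swap]; simp)
      calc Valued.v (f w - f z) * (c⁻¹ * c⁻¹) ≤ (Valued.v (z - w) * c) * (c⁻¹ * c⁻¹) :=
            mul_le_mul' h le_rfl
        _ = c⁻¹ * Valued.v (z - w) := by field_simp
        _ ≤ _ := mul_le_mul' hcinv le_rfl)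
  refine ⟨z + emb F (Q j), by simpa using hz, ?_⟩
  rw [← Finset.mul_prod_erase _ _ (Finset.mem_univ j)]
  have : ∏ i ∈ Finset.univ.erase j, (z + emb F (Q j) - emb F (Q i)) = f z :=
    Finset.prod_congr rfl fun i _ => by rw [hΔ]; ring
  rw [this, add_sub_cancel_right]
  nth_rewrite 1 [← hfix]
  exact inv_mul_cancel₀ (hf0 z hz)

theorem natDegree_prod_X_sub_C {R : Type*} [CommRing R] [Nontrivial R] (r : Fin d → R) :
    (∏ i, (X - C (r i))).natDegree = d := by
  rw [natDegree_prod_of_monic _ _ fun i _ => monic_X_sub_C _]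
  simp

theorem degree_prod_X_sub_C {R : Type*} [CommRing R] [Nontrivial R] (r : Fin d → R) :
    (∏ i, (X - C (r i))).degree = (d : WithBot ℕ) := by
  rw [degree_eq_natDegree (monic_prod_of_monic _ _ fun i _ => monic_X_sub_C _).ne_zero,
    natDegree_prod_X_sub_C]

theorem monic_prod_X_sub_C_sub_one {R : Type*} [CommRing R] [Nontrivial R] (hd : 0 < d)
    (r : Fin d → R) : (∏ i, (X - C (r i)) - 1).Monic := by
  refine (monic_prod_of_monic _ _ fun i _ => monic_X_sub_C _).sub_of_left ?_
  rw [degree_prod_X_sub_C, degree_one]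
  exact_mod_cast hd

theorem degree_prod_X_sub_C_sub_one {R : Type*} [CommRing R] [Nontrivial R] (hd : 0 < d)
    (r : Fin d → R) : (∏ i, (X - C (r i)) - 1).degree = (d : WithBot ℕ) := by
  rw [degree_sub_eq_left_of_degree_lt, degree_prod_X_sub_C]
  rw [degree_prod_X_sub_C, degree_one]
  exact_mod_cast hd

/-- `P` is the product of the `T - θ_j` over its roots. -/
theorem prod_X_sub_C_sub_one_eq {K : Type*} [Field K] (hd : 0 < d) (r θ : Fin d → K)
    (hθ : Function.Injective θ) (h : ∀ j, ∏ i, (θ j - r i) = 1) :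
    ∏ i, (X - C (r i)) - 1 = ∏ i, (X - C (θ i)) := by
  refine eq_of_degree_le_of_eval_index_eq Finset.univ (v := θ) (hθ.injOn) ?_ ?_ ?_ ?_
  · rw [degree_prod_X_sub_C_sub_one hd]; simp
  · rw [degree_prod_X_sub_C_sub_one hd, degree_prod_X_sub_C]
  · rw [(monic_prod_X_sub_C_sub_one hd r).leadingCoeff,
      (monic_prod_of_monic _ _ fun i _ => monic_X_sub_C _).leadingCoeff]
  · intro j _
    rw [eval_sub, eval_prod, eval_prod, eval_one]
    simp only [eval_sub, eval_X, eval_C, h, sub_self]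
    exact (Finset.prod_eq_zero (Finset.mem_univ j) (sub_self _)).symm

/-- By Gauss's lemma it suffices to treat monic factors `A`, `B` over `F[x]`. As `P(Q_k) = -1`, each
`B(Q_k)` is a nonzero constant. Over `F((x⁻¹))` the two factors share out the roots; if `θ_k` goes
to `A`, then `|B(Q_k)|` is a product of distances `|Q_k - θ_i| > 1` with `i ≠ k`, so `B` has no root
at all. -/
theorem irreducible_polyP (hd : 2 ≤ d) (hQ : Separated Q) : Irreducible (polyP Q) := by
  choose θ hθ hroot using exists_root_near hd hQ
  have hinj : Function.Injective θ := fun i j hij => hQ.eq_of_near (hθ i) (hij ▸ hθ j)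
  set p : F[X][X] := ∏ i, (X - C (Q i)) - 1 with hp
  have hmonic : p.Monic := monic_prod_X_sub_C_sub_one (by omega) Q
  have hmap : polyP Q = p.map (algebraMap F[X] (RatFunc F)) := by
    simp [polyP, hp, Polynomial.map_prod]
  have hmapK : p.map (emb F) = ∏ i, (X - C (θ i)) := by
    rw [← prod_X_sub_C_sub_one_eq (by omega) (fun i => emb F (Q i)) θ hinj hroot]
    simp [hp, Polynomial.map_prod]
  rw [hmap, ← hmonic.irreducible_iff_irreducible_map_fraction_map]
  refine (irreducible_of_monic hmonic ?_).mpr ?_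
  · intro h
    have := degree_prod_X_sub_C_sub_one (show 0 < d by omega) Q
    rw [← hp, h, degree_one] at this
    have : 0 = d := by exact_mod_cast this
    omega
  intro A B hA hB hAB
  have hval : ∀ k, IsUnit (B.eval (Q k)) := fun k => by
    refine IsUnit.of_mul_eq_one (-A.eval (Q k)) ?_
    have : A.eval (Q k) * B.eval (Q k) = -1 := by
      rw [← eval_mul, hAB, hp, eval_sub, eval_prod, Finset.prod_eq_zero (Finset.mem_univ k)]
      · simp
      · simp
    linear_combination -this
  obtain ⟨t, u, b, c, htu, hdisj, hbc, hAt, hBu⟩ := mul_eq_mul_prime_prod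
    (x := A.map (emb F)) (y := B.map (emb F)) (a := 1) (s := Finset.univ)
    (p := fun i => X - C (θ i)) (fun i _ => prime_X_sub_C _)
    (by rw [← Polynomial.map_mul, hAB, hmapK, one_mul])
  have hbM : b.Monic := (monic_prod_of_monic _ _ fun i _ => monic_X_sub_C _).of_mul_monic_right
    (hAt ▸ hA.map _)
  have hcM : c.Monic := (monic_prod_of_monic _ _ fun i _ => monic_X_sub_C _).of_mul_monic_right
    (hBu ▸ hB.map _)
  have hb : b = 1 := hbM.isUnit_iff.mp (IsUnit.of_mul_eq_one c hbc.symm)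
  have hc : c = 1 := hcM.isUnit_iff.mp (IsUnit.of_mul_eq_one_right b hbc.symm)
  rw [hb, one_mul] at hAt
  rw [hc, one_mul] at hBu
  rcases t.eq_empty_or_nonempty with ht | ⟨k, hk⟩
  · left
    rw [ht, Finset.prod_empty] at hAt
    exact Polynomial.map_injective _ emb_injective (by rw [hAt, Polynomial.map_one])
  rcases u.eq_empty_or_nonempty with hu | hu
  · right
    rw [hu, Finset.prod_empty] at hBu
    exact Polynomial.map_injective _ emb_injective (by rw [hBu, Polynomial.map_one])
  exfalso
  have h1 := v_emb_of_isUnit (hval k)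
  rw [← Polynomial.eval_map_apply, hBu, eval_prod, map_prod] at h1
  refine absurd h1 (one_lt_finset_prod hu fun i hi => ?_).ne'
  have hik : i ≠ k := fun h => Finset.disjoint_left.mp hdisj hk (h ▸ hi)
  rw [eval_sub, eval_X, eval_C, Valuation.map_sub_swap, v_sub_emb hQ hik (hθ i)]
  exact hQ i k hik

/-! ### Embeddings into the completion -/

theorem prod_map_theta_sub {A : Type*} [CommRing A] [Algebra (RatFunc F) A]
    (f : FieldQ Q →ₐ[RatFunc F] A) :
    ∏ i, (f (theta Q) - algebraMap (RatFunc F) A (algebraMap F[X] (RatFunc F) (Q i))) = 1 := by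
  rw [← sub_eq_zero, ← aeval_polyP, aeval_algHom_apply, theta, AdjoinRoot.aeval_eq,
    AdjoinRoot.mk_self, map_zero]

end Field

section Fintype

variable {F : Type*} [Field F] [Fintype F]

theorem one_lt_card_nnreal : (1 : ℝ≥0) < Fintype.card F := by
  exact_mod_cast Fintype.one_lt_card

theorem absInf_le_one {z : Kinf F} : absInf z ≤ 1 ↔ Valued.v z ≤ 1 :=
  WithZeroMulInt.toNNReal_le_one_iff one_lt_card_nnreal

variable {d : ℕ} {Q : Fin d → F[X]}

theorem IsOrdering.v_le_one {σ : Fin d → (FieldQ Q →ₐ[RatFunc F] Kinf F)} (h : IsOrdering Q σ)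
    (j : Fin d) : Valued.v (σ j (theta Q) - emb F (Q j)) ≤ 1 :=
  absInf_le_one.mp (h.2 j)

/-- An embedding sends `θ` to one of the `d` roots already found and is determined by it. No root is
near two of the `Q_j`, so the order is forced. -/
theorem existsUnique_isOrdering (hd : 2 ≤ d) (hQ : Separated Q) :
    ∃! σ, IsOrdering Q σ := by
  choose θ hθ hroot using exists_root_near hd hQ
  have hinj : Function.Injective θ := fun i j hij => hQ.eq_of_near (hθ i) (hij ▸ hθ j)
  let σ : Fin d → (FieldQ Q →ₐ[RatFunc F] Kinf F) := fun j =>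
    AdjoinRoot.liftAlgHom (polyP Q) (Algebra.ofId _ _) (θ j) (by
      have := aeval_Kinf_polyP Q (θ j)
      rw [hroot, sub_self] at this
      exact this)
  have hσ : ∀ j, σ j (theta Q) = θ j := fun j => AdjoinRoot.liftAlgHom_root _ _ _ _
  have hsurj : Function.Surjective σ := fun f => by
    have h1 : ∏ i, (f (theta Q) - emb F (Q i)) = 1 := prod_map_theta_sub f
    have h2 := congrArg (eval (f (theta Q)))
      (prod_X_sub_C_sub_one_eq (by omega) (fun i => emb F (Q i)) θ hinj hroot)
    simp only [eval_sub, eval_prod, eval_X, eval_C, eval_one, h1, sub_self] at h2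
    obtain ⟨i, -, hi⟩ := Finset.prod_eq_zero_iff.mp h2.symm
    refine ⟨i, AdjoinRoot.algHom_ext ?_⟩
    exact (hσ i).trans (sub_eq_zero.mp hi).symm
  refine ⟨σ, ⟨⟨fun i j hij => hinj ?_, hsurj⟩, fun j => ?_⟩, fun τ hτ => ?_⟩
  · rw [← hσ, ← hσ, hij]
  · rw [hσ]
    exact absInf_le_one.mpr (hθ j)
  · funext j
    obtain ⟨i, hi⟩ := hsurj (τ j)
    have h1 := hτ.v_le_one j
    rw [← hi, hσ] at h1
    rw [← hi, hQ.eq_of_near (hθ i) h1]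

end Fintype

/-! ### The order `Λ` and the shifted grid in the field -/

section Field

variable {F : Type*} [Field F] {d : ℕ} {Q : Fin d → F[X]}

theorem aeval_theta (Q : Fin d → F[X]) : aeval (theta Q) (polyP Q) = 0 := by
  rw [theta, AdjoinRoot.aeval_eq, AdjoinRoot.mk_self]

theorem omega_eq (Q : Fin d → F[X]) (l : Fin d) :
    omega Q l = theta Q - algebraMap F[X] (FieldQ Q) (Q l) := by
  rw [omega, ← IsScalarTower.algebraMap_apply]

theorem prod_omega (Q : Fin d → F[X]) : ∏ l, omega Q l = 1 := by
  have h := aeval_theta Q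
  rwa [aeval_polyP, sub_eq_zero] at h

/-- `θ` is a root of a monic polynomial of degree `d` over `F[x]`. The point is that `Λ` is a ring,
hence stable under the `ω_l`. -/
theorem lamQ_eq_adjoin (hd : 0 < d) (Q : Fin d → F[X]) :
    lamQ Q = Subalgebra.toSubmodule (Algebra.adjoin F[X] {theta Q}) := by
  set p : F[X][X] := ∏ i, (X - C (Q i)) - 1 with hp
  have hdeg : p.natDegree = d :=
    natDegree_eq_of_degree_eq_some (degree_prod_X_sub_C_sub_one hd Q)
  have h0 : aeval (theta Q) p = 0 := by
    have := prod_omega Q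
    simp only [omega_eq] at this
    simp [hp, map_prod, this]
  rw [← Submodule.span_range_natDegree_eq_adjoin (monic_prod_X_sub_C_sub_one hd Q) h0, ← hp, hdeg,
    lamQ]
  congr 1
  ext z
  simp only [Set.mem_range, Finset.coe_image, Finset.coe_range, Set.mem_image, Set.mem_Iio]
  exact ⟨fun ⟨k, hk⟩ => ⟨k, k.2, hk⟩, fun ⟨k, hk, hz⟩ => ⟨⟨k, hk⟩, hz⟩⟩

theorem mem_lamQ_iff {z : FieldQ Q} :
    z ∈ lamQ Q ↔ ∃ b : Fin d → F[X], ∑ k, b k • theta Q ^ (k : ℕ) = z :=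
  Submodule.mem_span_range_iff_exists_fun _

/-- A product of `n` factors `θ - x r_l` is congruent to `θ ^ n` modulo `x`. -/
theorem exists_prod_sub_eq {R A : Type*} [CommRing R] [CommRing A] [Algebra R A] (θ : A)
    {ι : Type*} (s : Finset ι) (x : R) (r : ι → R) :
    ∃ u ∈ Algebra.adjoin R {θ}, ∏ i ∈ s, (θ - algebraMap R A (x * r i)) = θ ^ s.card + x • u := by
  classical
  induction s using Finset.induction_on with
  | empty => exact ⟨0, zero_mem _, by simp⟩
  | insert i s hi ih =>
    obtain ⟨u, hu, h⟩ := ih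
    have hθ : θ ∈ Algebra.adjoin R {θ} := Algebra.self_mem_adjoin_singleton R θ
    refine ⟨θ * u - algebraMap R A (r i) * (θ ^ s.card + x • u),
      sub_mem (mul_mem hθ hu) (mul_mem (Subalgebra.algebraMap_mem _ _)
        (add_mem (pow_mem hθ _) (Subalgebra.smul_mem _ hu _))), ?_⟩
    rw [Finset.prod_insert hi, h, Finset.card_insert_of_notMem hi, Algebra.smul_def,
      Algebra.smul_def, map_mul]
    ring

/-- The grid `Λ + x⁻¹ (1 + θ + ⋯ + θ ^ (d - 1))` in the field `F(x)(θ)`. -/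
def gridE (Q : Fin d → F[X]) : Set (FieldQ Q) :=
  {z | ∃ w ∈ lamQ Q, z = w + algebraMap (RatFunc F) (FieldQ Q) (algebraMap F[X] (RatFunc F) X)⁻¹ *
    ∑ k ∈ Finset.range d, theta Q ^ k}

/-- With `s = 1 + ⋯ + θ^(d-1)`, the identity `θ s = s + θ^d - 1` and `θ^d ≡ 1` modulo `xΛ` give `θ s
/ x ≡ s / x` modulo `Λ`; and `Q_l s / x` lies in `Λ`. -/
theorem omega_mul_mem_gridE (hd : 0 < d) (hx : ∀ l, (X : F[X]) ∣ Q l) (l : Fin d) {z : FieldQ Q}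
    (hz : z ∈ gridE Q) : omega Q l * z ∈ gridE Q := by
  choose r hr using hx
  obtain ⟨w, hw, rfl⟩ := hz
  set c := algebraMap (RatFunc F) (FieldQ Q) (algebraMap F[X] (RatFunc F) X)⁻¹ with hc
  set s := ∑ k ∈ Finset.range d, theta Q ^ k with hs
  have hcx : c * algebraMap F[X] (FieldQ Q) X = 1 := by
    rw [hc, IsScalarTower.algebraMap_apply F[X] (RatFunc F) (FieldQ Q), ← map_mul,
      inv_mul_cancel₀, map_one]
    exact (map_ne_zero_iff _ (IsFractionRing.injective F[X] (RatFunc F))).mpr X_ne_zero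
  obtain ⟨u, hu, h⟩ := exists_prod_sub_eq (theta Q) Finset.univ (X : F[X]) r
  have hω : ∏ i, (theta Q - algebraMap F[X] (FieldQ Q) (X * r i)) = 1 := by
    rw [← prod_omega Q]
    exact Finset.prod_congr rfl fun i _ => by rw [omega_eq, hr i]
  rw [hω, Finset.card_univ, Fintype.card_fin, Algebra.smul_def] at h
  have hgeom : s * (theta Q - 1) = theta Q ^ d - 1 := geom_sum_mul _ _
  have hθ : theta Q ∈ Algebra.adjoin F[X] {theta Q} := Algebra.self_mem_adjoin_singleton _ _
  rw [lamQ_eq_adjoin hd, Subalgebra.mem_toSubmodule] at hw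
  refine ⟨omega Q l * w - u - algebraMap F[X] (FieldQ Q) (r l) * s, ?_, ?_⟩
  · rw [lamQ_eq_adjoin hd, Subalgebra.mem_toSubmodule, omega_eq]
    exact sub_mem (sub_mem (mul_mem (sub_mem hθ (Subalgebra.algebraMap_mem _ _)) hw) hu)
      (mul_mem (Subalgebra.algebraMap_mem _ _) (sum_mem fun k _ => pow_mem hθ k))
  · have hωl : omega Q l = theta Q - algebraMap F[X] (FieldQ Q) X * algebraMap F[X] (FieldQ Q) (r l) := by
      rw [omega_eq, ← map_mul, ← hr]
    rw [hωl]
    linear_combination c * hgeom - c * h - (u + algebraMap F[X] (FieldQ Q) (r l) * s) * hcx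

theorem mem_gridE_iff {z : FieldQ Q} :
    z ∈ gridE Q ↔ ∃ b : Fin d → F[X], z = ∑ k : Fin d, algebraMap (RatFunc F) (FieldQ Q)
      (algebraMap F[X] (RatFunc F) (b k) + (algebraMap F[X] (RatFunc F) X)⁻¹) *
        theta Q ^ (k : ℕ) := by
  have h : ∀ b : Fin d → F[X], ∑ k : Fin d, algebraMap (RatFunc F) (FieldQ Q)
      (algebraMap F[X] (RatFunc F) (b k) + (algebraMap F[X] (RatFunc F) X)⁻¹) *
        theta Q ^ (k : ℕ) = ∑ k, b k • theta Q ^ (k : ℕ) +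
        algebraMap (RatFunc F) (FieldQ Q) (algebraMap F[X] (RatFunc F) X)⁻¹ *
          ∑ k ∈ Finset.range d, theta Q ^ k := fun b => by
    simp only [map_add, add_mul, Finset.sum_add_distrib, Finset.mul_sum, Finset.sum_range,
      Algebra.smul_def]
    rfl
  simp only [h, gridE, Set.mem_ofPred_eq, mem_lamQ_iff, exists_exists_eq_and]

/-- A nonzero polynomial has absolute value at least `1` and dominates `1/x`. This bound is the
source of the factor `q⁻¹` per coordinate. -/
theorem v_emb_add_inv (b : F[X]) :
    WithZero.exp (-1) ≤ Valued.v (emb F b + (emb F X)⁻¹) := by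
  have hX : Valued.v (emb F X)⁻¹ = WithZero.exp (-1) := by
    rw [map_inv₀, v_emb X_ne_zero, natDegree_X, ← WithZero.exp_neg]
    rfl
  by_cases hb : b = 0
  · rw [hb, map_zero, zero_add, hX]
  · rw [Valuation.map_add_eq_of_lt_left]
    · refine le_trans ?_ (one_le_v_emb hb)
      rw [← WithZero.exp_zero, WithZero.exp_le_exp]
      omega
    · rw [hX]
      refine lt_of_lt_of_le ?_ (one_le_v_emb hb)
      rw [← WithZero.exp_zero, WithZero.exp_lt_exp]
      omega

theorem coeff_sum_fin {R : Type*} [Semiring R] (c : Fin d → R) (i : Fin d) :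
    (∑ k : Fin d, C (c k) * X ^ (k : ℕ)).coeff i = c i := by
  simp [finsetSum_coeff, Fin.val_inj]

/-- The constant coefficient `b_0 + 1/x` is nonzero, and `P` has degree `d`. Logarithms of the
coordinates are therefore never the default value at `0`. -/
theorem ne_zero_of_mem_gridE (hd : 0 < d) {z : FieldQ Q} (hz : z ∈ gridE Q) : z ≠ 0 := by
  obtain ⟨b, rfl⟩ := mem_gridE_iff.mp hz
  set c : Fin d → RatFunc F := fun k =>
    algebraMap F[X] (RatFunc F) (b k) + (algebraMap F[X] (RatFunc F) X)⁻¹ with hc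
  have hmonic : (polyP Q).Monic := monic_prod_X_sub_C_sub_one hd _
  have hdeg : (polyP Q).degree = (d : WithBot ℕ) := degree_prod_X_sub_C_sub_one hd _
  set p : (RatFunc F)[X] := ∑ k : Fin d, C (c k) * X ^ (k : ℕ) with hp
  have hpd : p.degree < (d : WithBot ℕ) := degree_sum_fin_lt c
  have hcoeff : p.coeff (⟨0, hd⟩ : Fin d) = c ⟨0, hd⟩ := coeff_sum_fin c _
  have hc0 : c ⟨0, hd⟩ ≠ 0 := by
    intro h
    have h1 := v_emb_add_inv (b ⟨0, hd⟩)
    have h2 : emb F (b ⟨0, hd⟩) + (emb F X)⁻¹ = algebraMap (RatFunc F) (Kinf F) (c ⟨0, hd⟩) := by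
      simp [emb, hc]
    rw [h2, h, map_zero, map_zero] at h1
    exact absurd h1 (not_le.mpr WithZero.exp_pos)
  have hp0 : p ≠ 0 := fun h => hc0 (by rw [← hcoeff, h, coeff_zero])
  have := AdjoinRoot.mk_ne_zero_of_degree_lt hmonic hp0 (hdeg ▸ hpd)
  rw [← AdjoinRoot.aeval_eq] at this
  simpa only [hp, theta, map_sum, map_mul, map_pow, aeval_C, aeval_X] using this

/-- Some coordinate of a point of the grid is large, by Lagrange interpolation. -/
theorem exists_large_of_mem_gridE (hd : 0 < d) (σ : Fin d → (FieldQ Q →ₐ[RatFunc F] Kinf F))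
    (hσ : Function.Injective fun i => σ i (theta Q)) {z : FieldQ Q} (hz : z ∈ gridE Q) :
    ∃ i, WithZero.exp (-1) *
      ∏ l ∈ Finset.univ.erase i, Valued.v (σ i (theta Q) - σ l (theta Q)) ≤ Valued.v (σ i z) := by
  obtain ⟨b, rfl⟩ := mem_gridE_iff.mp hz
  set c : Fin d → Kinf F := fun k => emb F (b k) + (emb F X)⁻¹ with hc
  set p : (Kinf F)[X] := ∑ k : Fin d, C (c k) * X ^ (k : ℕ) with hp
  have hpd : p.degree < (Finset.univ : Finset (Fin d)).card := by
    simpa using degree_sum_fin_lt c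
  have heval : ∀ i, σ i (∑ k : Fin d, algebraMap (RatFunc F) (FieldQ Q)
      (algebraMap F[X] (RatFunc F) (b k) + (algebraMap F[X] (RatFunc F) X)⁻¹) *
        theta Q ^ (k : ℕ)) = p.eval (σ i (theta Q)) := fun i => by
    rw [hp, eval_finsetSum, map_sum]
    refine Finset.sum_congr rfl fun k _ => ?_
    rw [map_mul, AlgHom.commutes, map_pow, eval_mul, eval_C, eval_pow, eval_X, map_add, map_inv₀]
    rfl
  simp only [heval]
  by_contra! hcon
  -- The top coefficient is `∑ σ_i(z) / ∏_{l≠i} (θ_i - θ_l)`; if all terms were smaller than `q⁻¹`,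
  -- so would be the sum.
  have h := Lagrange.coeff_eq_sum (s := Finset.univ) hσ.injOn hpd
  have h1 : p.coeff ((Finset.univ : Finset (Fin d)).card - 1) = c ⟨d - 1, by omega⟩ := by
    rw [Finset.card_univ, Fintype.card_fin]
    exact coeff_sum_fin c ⟨d - 1, by omega⟩
  rw [h1] at h
  refine absurd (v_emb_add_inv (b ⟨d - 1, by omega⟩)) (not_le.mpr ?_)
  have h2 : emb F (b ⟨d - 1, by omega⟩) + (emb F X)⁻¹ = _ := h
  rw [h2]
  refine Valuation.map_sum_lt _ WithZero.exp_ne_zero fun i _ => ?_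
  rw [map_div₀, map_prod, div_lt_iff₀]
  · exact hcon i
  · rw [zero_lt_iff, Finset.prod_ne_zero_iff]
    intro l hl
    rw [Valuation.ne_zero_iff, sub_ne_zero]
    exact fun h => Finset.ne_of_mem_erase hl (hσ h).symm

/-! ### The norm bound by chip-firing -/

theorem v_map_omega_of_ne (hQ : Separated Q) {σ : Fin d → (FieldQ Q →ₐ[RatFunc F] Kinf F)}
    (hσ : ∀ j, Valued.v (σ j (theta Q) - emb F (Q j)) ≤ 1) {i j : Fin d} (hij : j ≠ i) :
    Valued.v (σ j (omega Q i)) = Valued.v (emb F (Q j) - emb F (Q i)) := by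
  rw [← v_sub_emb hQ hij (hσ j), omega, map_sub, AlgHom.commutes]
  rfl

theorem v_map_omega_self (hQ : Separated Q) {σ : Fin d → (FieldQ Q →ₐ[RatFunc F] Kinf F)}
    (hσ : ∀ j, Valued.v (σ j (theta Q) - emb F (Q j)) ≤ 1) (i : Fin d) :
    Valued.v (σ i (omega Q i)) *
      ∏ l ∈ Finset.univ.erase i, Valued.v (emb F (Q i) - emb F (Q l)) = 1 := by
  have h := congrArg (fun z => Valued.v (σ i z)) (prod_omega Q)
  simp only [map_prod, map_one] at h
  rw [← h, ← Finset.mul_prod_erase _ _ (Finset.mem_univ i)]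
  congr 1
  refine Finset.prod_congr rfl fun l hl => ?_
  rw [v_map_omega_of_ne hQ hσ (Finset.ne_of_mem_erase hl).symm]

theorem log_prod {ι : Type*} (s : Finset ι) (f : ι → ℤᵐ⁰) (hf : ∀ i ∈ s, f i ≠ 0) :
    WithZero.log (∏ i ∈ s, f i) = ∑ i ∈ s, WithZero.log (f i) := by
  classical
  induction s using Finset.induction_on with
  | empty => simp
  | insert i s hi ih =>
    simp only [Finset.forall_mem_insert] at hf
    rw [Finset.prod_insert hi, Finset.sum_insert hi, WithZero.log_mul hf.1
      (Finset.prod_ne_zero_iff.mpr hf.2), ih hf.2]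

/-- The lower bound for the norm on the grid, with the discriminant of `θ` on the left. -/
theorem prod_prod_le_of_mem_gridE (hd : 0 < d) (hQ : Separated Q) (hx : ∀ l, (X : F[X]) ∣ Q l)
    (hirr : Irreducible (polyP Q)) {σ : Fin d → (FieldQ Q →ₐ[RatFunc F] Kinf F)}
    (hσ : ∀ j, Valued.v (σ j (theta Q) - emb F (Q j)) ≤ 1) {z : FieldQ Q} (hz : z ∈ gridE Q) :
    ∏ i, ∏ l ∈ Finset.univ.erase i, Valued.v (emb F (Q i) - emb F (Q l)) ≤
      (WithZero.exp (d : ℤ) * ∏ i, Valued.v (σ i z)) ^ 2 := by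
  have : Fact (Irreducible (polyP Q)) := ⟨hirr⟩
  set V : Fin d → Fin d → ℤᵐ⁰ := fun i l => Valued.v (emb F (Q i) - emb F (Q l)) with hV
  set L : Fin d → Fin d → ℤ := fun i l => WithZero.log (V i l) with hLdef
  have hV1 : ∀ i l, i ≠ l → 1 < V i l := hQ
  have hV0 : ∀ i l, i ≠ l → V i l ≠ 0 := fun i l h => (zero_lt_one.trans (hV1 i l h)).ne'
  have hVp : ∀ i, ∀ l ∈ Finset.univ.erase i, V i l ≠ 0 :=
    fun i l hl => hV0 i l (Finset.ne_of_mem_erase hl).symm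
  have hL : ∀ i l, i ≠ l → 1 ≤ L i l := fun i l h => by
    have := hV1 i l h
    rw [← WithZero.exp_log (hV0 i l h), ← WithZero.exp_zero, WithZero.exp_lt_exp] at this
    exact this
  have hinj : Function.Injective fun i => σ i (theta Q) := fun i j hij => by
    have hij : σ i (theta Q) = σ j (theta Q) := hij
    exact hQ.eq_of_near (hσ i) (hij ▸ hσ j)
  have hne : ∀ w ∈ gridE Q, ∀ i, Valued.v (σ i w) ≠ 0 := fun w hw i => by
    rw [Valuation.ne_zero_iff]
    exact (map_ne_zero_iff _ (σ i : FieldQ Q →+* Kinf F).injective).mpr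
      (ne_zero_of_mem_gridE hd hw)
  -- The `+ 1` absorbs the factor `q⁻¹` in the bound for the large coordinate, so that this bound
  -- becomes exactly the legality of firing `i`. Multiplying by `ω_i` carries out the move.
  have key := sum_le_two_mul_sum_of_forall_exists_fire L hL
    (fun i j => by simp only [hLdef, hV, Valuation.map_sub_swap])
    {D | ∃ w ∈ gridE Q, ∀ i, D i = WithZero.log (Valued.v (σ i w)) + 1} (by
      rintro D ⟨w, hw, hD⟩
      obtain ⟨i, hi⟩ := exists_large_of_mem_gridE hd σ hinj hw
      have hi' : WithZero.exp (-1) * ∏ l ∈ Finset.univ.erase i, V i l ≤ Valued.v (σ i w) := by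
        refine le_trans (le_of_eq ?_) hi
        congr 1
        refine Finset.prod_congr rfl fun l hl => ?_
        exact (v_sub_of_near hQ (Finset.ne_of_mem_erase hl).symm (hσ i) (hσ l)).symm
      have hp0 : ∏ l ∈ Finset.univ.erase i, V i l ≠ 0 := Finset.prod_ne_zero_iff.mpr (hVp i)
      refine ⟨i, ?_, omega Q i * w, omega_mul_mem_gridE hd hx i hw, fun j => ?_⟩
      · rw [← WithZero.exp_log (hne w hw i), ← WithZero.exp_log hp0, ← WithZero.exp_add,
          WithZero.exp_le_exp, log_prod _ _ (hVp i)] at hi'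
        rw [hD]
        linarith
      · have hω0 : Valued.v (σ j (omega Q i)) ≠ 0 := fun h0 => by
          apply hne _ (omega_mul_mem_gridE hd hx i hw) j
          rw [map_mul, map_mul, h0, zero_mul]
        rw [map_mul, map_mul, WithZero.log_mul hω0 (hne w hw j)]
        by_cases hji : j = i
        · subst hji
          have h1 := congrArg WithZero.log (v_map_omega_self hQ hσ j)
          rw [WithZero.log_mul hω0 hp0, log_prod _ _ (hVp j), WithZero.log_one] at h1
          simp only [fire, if_true, hD]
          linarith
        · simp only [fire, if_neg hji, hD]
          rw [v_map_omega_of_ne hQ hσ hji, Valuation.map_sub_swap]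
          ring) _ ⟨z, hz, fun i => rfl⟩
  have hz0 : ∏ i, Valued.v (σ i z) ≠ 0 := Finset.prod_ne_zero_iff.mpr fun i _ => hne z hz i
  have hVV : ∀ i ∈ (Finset.univ : Finset (Fin d)), ∏ l ∈ Finset.univ.erase i, V i l ≠ 0 :=
    fun i _ => Finset.prod_ne_zero_iff.mpr (hVp i)
  rw [← WithZero.exp_log (Finset.prod_ne_zero_iff.mpr hVV), ← WithZero.exp_log hz0,
    ← WithZero.exp_add, ← WithZero.exp_nsmul, WithZero.exp_le_exp, log_prod _ _ hVV,
    log_prod _ _ fun i _ => hne z hz i]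
  have h3 : ∑ i, WithZero.log (∏ l ∈ Finset.univ.erase i, V i l) =
      ∑ i, ∑ l ∈ Finset.univ.erase i, L i l :=
    Finset.sum_congr rfl fun i _ => log_prod _ _ (hVp i)
  rw [h3]
  refine key.trans (le_of_eq ?_)
  rw [Finset.sum_add_distrib]
  simp
  ring

/-! ### Determinants -/

theorem matTheta_eq_vandermonde (σ : Fin d → (FieldQ Q →ₐ[RatFunc F] Kinf F)) :
    matTheta Q σ = Matrix.vandermonde fun i => σ i (theta Q) := by
  ext i j
  rw [matTheta, Matrix.of_apply, Matrix.vandermonde_apply]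

/-- The products `ω_1 ⋯ ω_{j-1}` are monic of degree `j - 1` in `θ`, so the change of basis is
unitriangular. -/
theorem det_matM (σ : Fin d → (FieldQ Q →ₐ[RatFunc F] Kinf F)) :
    (matM Q σ).det = (matTheta Q σ).det := by
  have h := Matrix.det_eval_matrixOfPolynomials_eq_det_vandermonde (fun i => σ i (theta Q))
    (fun j => ∏ l ∈ Finset.Iio j, (X - C (emb F (Q l))))
    (fun j => by
      rw [natDegree_prod_of_monic _ _ fun i _ => monic_X_sub_C _]
      simp)
    (fun j => monic_prod_of_monic _ _ fun i _ => monic_X_sub_C _)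
  rw [matTheta_eq_vandermonde, h]
  congr 1
  ext i j
  rw [matM, Matrix.of_apply, Matrix.of_apply, map_prod, eval_prod]
  refine Finset.prod_congr rfl fun l _ => ?_
  rw [omega, map_sub, AlgHom.commutes, eval_sub, eval_X, eval_C]
  rfl

/-- In the Vandermonde product, `|θ_i - θ_l| = |Q_i - Q_l|`. Squaring passes to ordered pairs,
matching the double count of edges in the game. -/
theorem v_det_matTheta_sq (hQ : Separated Q) {σ : Fin d → (FieldQ Q →ₐ[RatFunc F] Kinf F)}
    (hσ : ∀ j, Valued.v (σ j (theta Q) - emb F (Q j)) ≤ 1) :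
    Valued.v (matTheta Q σ).det ^ 2 =
      ∏ i, ∏ l ∈ Finset.univ.erase i, Valued.v (emb F (Q i) - emb F (Q l)) := by
  set V : Fin d → Fin d → ℤᵐ⁰ := fun i l => Valued.v (emb F (Q i) - emb F (Q l)) with hV
  have h1 : Valued.v (matTheta Q σ).det = ∏ i, ∏ l ∈ Finset.Ioi i, V i l := by
    rw [matTheta_eq_vandermonde, Matrix.det_vandermonde, map_prod]
    refine Finset.prod_congr rfl fun i _ => ?_
    rw [map_prod]
    refine Finset.prod_congr rfl fun l hl => ?_
    rw [Valuation.map_sub_swap]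
    exact v_sub_of_near hQ (Finset.mem_Ioi.mp hl).ne (hσ i) (hσ l)
  have h2 : ∏ i, ∏ l ∈ Finset.Ioi i, V i l = ∏ i, ∏ l ∈ Finset.Iio i, V i l := by
    rw [Finset.prod_comm' (t' := Finset.univ) (s' := fun l => Finset.Iio l) (by simp)]
    refine Finset.prod_congr rfl fun i _ => Finset.prod_congr rfl fun l _ => ?_
    simp only [hV, Valuation.map_sub_swap]
  rw [sq]
  nth_rewrite 2 [h1]
  rw [h1, h2]
  nth_rewrite 1 [← h2]
  rw [← Finset.prod_mul_distrib]
  refine Finset.prod_congr rfl fun i _ => ?_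
  rw [← Finset.prod_union]
  · refine Finset.prod_congr ?_ fun _ _ => rfl
    ext l
    simp only [Finset.mem_union, Finset.mem_Ioi, Finset.mem_Iio, Finset.mem_erase,
      Finset.mem_univ, and_true]
    exact ⟨fun h => h.elim (fun h => h.ne') fun h => h.ne, fun h => h.lt_or_gt.symm⟩
  · rw [Finset.disjoint_left]
    intro l h3 h4
    exact lt_asymm (Finset.mem_Ioi.mp h3) (Finset.mem_Iio.mp h4)

theorem det_matTheta_ne_zero (hQ : Separated Q) {σ : Fin d → (FieldQ Q →ₐ[RatFunc F] Kinf F)}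
    (hσ : ∀ j, Valued.v (σ j (theta Q) - emb F (Q j)) ≤ 1) : (matTheta Q σ).det ≠ 0 := by
  rw [matTheta_eq_vandermonde, Matrix.det_vandermonde_ne_zero_iff]
  intro i j hij
  have hij : σ i (theta Q) = σ j (theta Q) := hij
  exact hQ.eq_of_near (hσ i) (hij ▸ hσ j)

end Field

/-! ### Lattices and their bases -/

section Field

variable {F : Type*} [Field F] {d : ℕ}

/-- The lattice `A F[x]^d` for an arbitrary square matrix `A`. -/
def matLattice (A : Matrix (Fin d) (Fin d) (Kinf F)) : Set (Fin d → Kinf F) :=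
  Set.range fun b : Fin d → F[X] => A *ᵥ fun k => emb F (b k)

theorem exists_eq_mul_map_of_subset {A B : Matrix (Fin d) (Fin d) (Kinf F)}
    (h : matLattice A ⊆ matLattice B) :
    ∃ U : Matrix (Fin d) (Fin d) F[X], A = B * U.map (emb F) := by
  have h1 : ∀ k : Fin d, ∃ b : Fin d → F[X], (B *ᵥ fun l => emb F (b l)) = A.col k := fun k => by
    have e : (fun l => emb F ((Pi.single k 1 : Fin d → F[X]) l)) = Pi.single k 1 := by
      funext l
      rw [Pi.single_apply, Pi.single_apply, apply_ite (emb F), map_one, map_zero]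
    have hk : A.col k ∈ matLattice A :=
      Set.mem_range.mpr ⟨Pi.single k 1, by rw [e, Matrix.mulVec_single_one]⟩
    exact Set.mem_range.mp (h hk)
  choose b hb using h1
  refine ⟨Matrix.of fun l k => b k l, ?_⟩
  ext i k
  have := congrFun (hb k) i
  rw [Matrix.col_apply] at this
  rw [← this]
  rfl

/-- The two bases differ by a matrix in `GL_d(F[x])`, whose determinant is a nonzero constant. Hence
the bound on `μ` does not depend on the representative. -/
theorem v_det_eq_of_matLattice_eq {A B : Matrix (Fin d) (Fin d) (Kinf F)}
    (h : matLattice A = matLattice B) (hA : A.det ≠ 0) : Valued.v A.det = Valued.v B.det := by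
  obtain ⟨U, hU⟩ := exists_eq_mul_map_of_subset h.subset
  obtain ⟨W, hW⟩ := exists_eq_mul_map_of_subset h.symm.subset
  have hU' : A.det = B.det * emb F U.det := by
    conv_lhs => rw [hU]
    rw [Matrix.det_mul, RingHom.map_det, RingHom.mapMatrix_apply]
  have hW' : B.det = A.det * emb F W.det := by
    conv_lhs => rw [hW]
    rw [Matrix.det_mul, RingHom.map_det, RingHom.mapMatrix_apply]
  have h1 : W.det * U.det = 1 := by
    apply emb_injective
    rw [map_mul, map_one]
    refine mul_left_cancel₀ hA ?_
    rw [← mul_assoc, ← hW', ← hU', mul_one]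
  rw [hU', map_mul, v_emb_of_isUnit (IsUnit.of_mul_eq_one_right _ h1), mul_one]

variable {Q : Fin d → F[X]}

theorem latticeX_eq_matLattice (σ : Fin d → (FieldQ Q →ₐ[RatFunc F] Kinf F)) :
    latticeX Q σ = matLattice (matTheta Q σ) := by
  have h : ∀ b : Fin d → F[X], (fun i => σ i (∑ k, b k • theta Q ^ (k : ℕ))) =
      matTheta Q σ *ᵥ fun k => emb F (b k) := fun b => by
    funext i
    rw [map_sum, Matrix.mulVec, dotProduct]
    refine Finset.sum_congr rfl fun k _ => ?_
    rw [Algebra.smul_def, map_mul, map_pow, mul_comm,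
      IsScalarTower.algebraMap_apply F[X] (RatFunc F) (FieldQ Q), AlgHom.commutes]
    rfl
  ext v
  simp only [latticeX, matLattice, Set.mem_image, SetLike.mem_coe, mem_lamQ_iff, Set.mem_range]
  constructor
  · rintro ⟨_, ⟨b, rfl⟩, rfl⟩
    exact ⟨b, (h b).symm⟩
  · rintro ⟨b, rfl⟩
    exact ⟨_, ⟨b, rfl⟩, h b⟩

theorem exists_mem_gridE_of_mem_gridY (σ : Fin d → (FieldQ Q →ₐ[RatFunc F] Kinf F))
    {v : Fin d → Kinf F} (hv : v ∈ gridY Q σ) : ∃ z ∈ gridE Q, v = fun i => σ i z := by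
  obtain ⟨b, rfl⟩ := hv
  refine ⟨_, mem_gridE_iff.mpr ⟨b, rfl⟩, ?_⟩
  funext i
  change ∑ k, matTheta Q σ i k * (emb F (b k) + (emb F X)⁻¹) = _
  refine Eq.trans (Finset.sum_congr rfl fun k _ => ?_) (map_sum (σ i) _ _).symm
  rw [map_mul, map_pow, mul_comm, AlgHom.commutes, map_add, map_inv₀]
  rfl

theorem matLattice_smul (c : Kinf F) (A : Matrix (Fin d) (Fin d) (Kinf F)) :
    matLattice (c • A) = (fun u => c • u) '' matLattice A := by
  rw [matLattice, matLattice, ← Set.range_comp]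
  congr 1
  funext b
  exact Matrix.smul_mulVec _ _ _

/-- Each difference is a nonzero multiple of `x`, hence of positive degree. -/
theorem separated_mul {a : Fin d → F[X]} (ha : Function.Injective a)
    (hx : ∀ j, (X : F[X]) ∣ a j) {q : F[X]} (hq : q ≠ 0) : Separated fun j => q * a j := by
  intro i j hij
  have h0 : a i - a j ≠ 0 := sub_ne_zero.mpr (ha.ne hij)
  have h1 : q * a i - q * a j ≠ 0 := by
    rw [← mul_sub]
    exact mul_ne_zero hq h0
  have h2 : (X : F[X]).natDegree ≤ (q * a i - q * a j).natDegree :=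
    natDegree_le_of_dvd (dvd_sub ((hx i).mul_left q) ((hx j).mul_left q)) h1
  rw [natDegree_X] at h2
  rw [← map_sub, v_emb h1, ← WithZero.exp_zero, WithZero.exp_lt_exp]
  omega

end Field

/-! ### From the grid to `μ` -/

section Fintype

variable {F : Type*} [Field F] [Fintype F] {d : ℕ}

theorem absInf_mul (z w : Kinf F) : absInf (z * w) = absInf z * absInf w := by
  simp [absInf]

theorem absInf_pow (z : Kinf F) (n : ℕ) : absInf (z ^ n) = absInf z ^ n := by
  simp [absInf]

theorem absInf_ne_zero {z : Kinf F} (hz : z ≠ 0) : absInf z ≠ 0 :=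
  WithZeroMulInt.toNNReal_ne_zero _ ((Valuation.ne_zero_iff _).mpr hz)

theorem prodN_smul (c : Kinf F) (v : Fin d → Kinf F) :
    prodN (c • v) = absInf c ^ d * prodN v := by
  simp [prodN, absInf_mul, Finset.prod_mul_distrib]

variable {Q : Fin d → F[X]}

theorem absInf_det_le_prodN (hd : 0 < d) (hQ : Separated Q) (hx : ∀ l, (X : F[X]) ∣ Q l)
    (hirr : Irreducible (polyP Q)) {σ : Fin d → (FieldQ Q →ₐ[RatFunc F] Kinf F)}
    (hσ : IsOrdering Q σ) {v : Fin d → Kinf F} (hv : v ∈ gridY Q σ) :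
    ((Fintype.card F : ℝ≥0) ^ d)⁻¹ * absInf (matTheta Q σ).det ≤ prodN v := by
  obtain ⟨z, hz, rfl⟩ := exists_mem_gridE_of_mem_gridY σ hv
  have h := prod_prod_le_of_mem_gridE hd hQ hx hirr hσ.v_le_one hz
  rw [← v_det_matTheta_sq hQ hσ.v_le_one, pow_le_pow_iff_left₀ zero_le zero_le two_ne_zero] at h
  have h' := (WithZeroMulInt.toNNReal_strictMono (one_lt_card_nnreal (F := F))).monotone h
  rw [map_mul, map_prod] at h'
  have hq : (0 : ℝ≥0) < (Fintype.card F : ℝ≥0) ^ d :=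
    pow_pos (zero_lt_one.trans one_lt_card_nnreal) d
  rw [inv_mul_le_iff₀ hq]
  refine h'.trans (le_of_eq ?_)
  congr 1

theorem exists_represents (hQ : Separated Q) {σ : Fin d → (FieldQ Q →ₐ[RatFunc F] Kinf F)}
    (hσ : IsOrdering Q σ) : ∃ g, Represents g (latticeX Q σ) := by
  refine ⟨Matrix.GeneralLinearGroup.mkOfDetNeZero (matTheta Q σ)
    (det_matTheta_ne_zero hQ hσ.v_le_one), 1, one_ne_zero, ?_⟩
  simp only [one_smul, Set.image_id', latticeX_eq_matLattice]
  rfl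

theorem le_mu_of_represents (hd : 0 < d) (hQ : Separated Q) (hx : ∀ l, (X : F[X]) ∣ Q l)
    (hirr : Irreducible (polyP Q)) {σ : Fin d → (FieldQ Q →ₐ[RatFunc F] Kinf F)}
    (hσ : IsOrdering Q σ) {g : GL (Fin d) (Kinf F)} (hg : Represents g (latticeX Q σ)) :
    ((Fintype.card F : ℝ≥0∞) ^ d)⁻¹ ≤ mu g := by
  obtain ⟨c, hc, hg⟩ := hg
  have hdet : (g : Matrix (Fin d) (Fin d) (Kinf F)).det ≠ 0 :=
    (Matrix.isUnits_det_units g).ne_zero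
  have hlat : matLattice (g : Matrix (Fin d) (Fin d) (Kinf F)) = matLattice (c • matTheta Q σ) := by
    rw [matLattice_smul, ← latticeX_eq_matLattice, ← hg]
    rfl
  have habs : absInf (g : Matrix (Fin d) (Fin d) (Kinf F)).det =
      absInf c ^ d * absInf (matTheta Q σ).det := by
    rw [← absInf_pow, ← absInf_mul, absInf, absInf, v_det_eq_of_matLattice_eq hlat hdet,
      Matrix.det_smul, Fintype.card_fin]
  have hq : (0 : ℝ≥0) < (Fintype.card F : ℝ≥0) ^ d :=
    pow_pos (zero_lt_one.trans one_lt_card_nnreal) d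
  have hcast : ((Fintype.card F : ℝ≥0∞) ^ d)⁻¹ = (((Fintype.card F : ℝ≥0) ^ d)⁻¹ : ℝ≥0) := by
    rw [ENNReal.coe_inv hq.ne']
    simp
  rw [mu, ENNReal.le_div_iff_mul_le (Or.inl (by simpa using absInf_ne_zero hdet))
    (Or.inl ENNReal.coe_ne_top), hcast, ← ENNReal.coe_mul]
  -- For this `v`, every `v - u` lies in `c • y`, and the factor `|c|^d` cancels against `|det g|`.
  refine le_trans ?_ (le_iSup _ (c • (matTheta Q σ *ᵥ fun _ => (emb F X)⁻¹)))
  refine le_iInf₂ fun u hu => ?_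
  rw [hg, latticeX_eq_matLattice] at hu
  obtain ⟨_, ⟨b, rfl⟩, rfl⟩ := hu
  rw [ENNReal.coe_le_coe, habs]
  have hy : (matTheta Q σ *ᵥ fun _ => (emb F X)⁻¹) - (matTheta Q σ *ᵥ fun k => emb F (b k)) ∈
      gridY Q σ := by
    rw [← Matrix.mulVec_sub]
    refine Set.mem_range.mpr ⟨fun k => -b k, congrArg _ (funext fun k => ?_)⟩
    rw [Pi.sub_apply, map_neg]
    ring
  simp only [← smul_sub]
  rw [prodN_smul, mul_left_comm]
  exact mul_le_mul' le_rfl (absInf_det_le_prodN hd hQ hx hirr hσ hy)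

end Fintype

end MinkFF

end

/-! ### The theorem -/

theorem mainTheorem4 {F : Type*} [Field F] [Fintype F] {d : ℕ} (hd : 2 ≤ d)
    (a : Fin d → F[X]) (ha : Function.Injective a) (hx : ∀ j, (X : F[X]) ^ 2 ∣ a j) :
    {Q : F[X] | ¬ (Irreducible (MinkFF.polyP fun j => Q * a j) ∧
      (∃! σ, MinkFF.IsOrdering (fun j => Q * a j) σ) ∧
      ∀ σ, MinkFF.IsOrdering (fun j => Q * a j) σ →
        (∀ v ∈ MinkFF.gridY (fun j => Q * a j) σ,
          ((Fintype.card F : ℝ≥0) ^ d)⁻¹ * MinkFF.absInf (MinkFF.matM (fun j => Q * a j) σ).det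
            ≤ MinkFF.prodN v) ∧
        (∃ g, MinkFF.Represents g (MinkFF.latticeX (fun j => Q * a j) σ)) ∧
        (∀ g, MinkFF.Represents g (MinkFF.latticeX (fun j => Q * a j) σ) →
          ((Fintype.card F : ℝ≥0∞) ^ d)⁻¹ ≤ MinkFF.mu g))}.Finite := by
  -- The only possible exception is `Q = 0`: for every other `Q` the polynomials `Q a_j` are
  -- separated.
  refine (Set.finite_singleton (0 : F[X])).subset fun Q hQ => ?_
  by_contra hQ0
  apply hQ
  have hd0 : 0 < d := by omega
  have hx1 : ∀ j, (X : F[X]) ∣ a j := fun j => (dvd_pow_self X two_ne_zero).trans (hx j)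
  have hxQ : ∀ j, (X : F[X]) ∣ Q * a j := fun j => (hx1 j).mul_left Q
  have hsep : MinkFF.Separated fun j => Q * a j := MinkFF.separated_mul ha hx1 hQ0
  have hirr := MinkFF.irreducible_polyP hd hsep
  refine ⟨hirr, MinkFF.existsUnique_isOrdering hd hsep, fun σ hσ => ⟨fun v hv => ?_,
    MinkFF.exists_represents hsep hσ, fun g hg =>
      MinkFF.le_mu_of_represents hd0 hsep hxQ hirr hσ hg⟩⟩
  rw [MinkFF.det_matM]
  exact MinkFF.absInf_det_le_prodN hd0 hsep hxQ hirr hσ hv
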